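/- Let $B$ be a finitely generated $\mathbb{C}$-algebra that is a unique factorization domain of Krull dimension at least $2$, and let $X=\operatorname{Spec} B$. Let $\delta$ be a $\mathbb{C}$-derivation of $B$ that is locally nilpotent (for every $b\in B$ there is $n\ge 0$ with $\delta^n(b)=0$; equivalently, $\delta$ comes from an algebraic action of the additive group $G_a$ on $X$) and irreducible (if $b\in B$ and $\delta(B)\subset bB$, then $b$ is a unit of $B$). Suppose that $A=\operatorname{Ker}\delta$ is finitely generated over $\mathbb{C}$ and that the quotient morphism $\pi:X\to Y=\operatorname{Spec} A$ induced by the inclusion $A\hookrightarrow B$ is faithfully flat. Then the following are equivalent. 1. $\pi$ is a trivial $\mathbb{A}^1$-bundle, i.e. $X\cong Y\times\mathbb{A}^1$ over $Y$. 2. There is $\alpha\in A$ such that the closed subset $V(\alpha)\subset Y$ has codimension one and (i) for every closed point $Q\in Y\setminus V(\alpha)$, the scheme-theoretic fiber of $\pi$ over $Q$ is isomorphic to $\mathbb{A}^1_{\mathbb{C}}$; (ii) for every prime element $f$ of $A$ dividing $\alpha$, the morphism $\operatorname{Spec}\operatorname{Ker}\delta_f\to\operatorname{Spec} A/fA$ induced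 by the natural map $A/fA\to\operatorname{Ker}\delta_f$ is birational, i.e. this map is an injection of integral domains inducing an isomorphism of their fraction fields; here $\delta_f$ is the derivation of $B/fB$ induced by $\delta$. -/

import Mathlib

open Polynomial

namespace GaQuotient

universe u v

section Derivations

variable {B : Type u} [CommRing B] [Algebra ℂ B]

/-- A derivation `δ` of `B` is locally nilpotent if every element of `B` is killed by some
iterate of `δ`. Locally nilpotent derivations of `B` are the same thing as `G_a`-actions on
`Spec B`. -/
def IsLocallyNilpotent (δ : Derivation ℂ B B) : Prop :=
  ∀ b : B, ∃ n : ℕ, (δ^[n]) b = 0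

/-- `δ` is irreducible if `δ(B) ⊆ bB` implies that `b` is a unit of `B`. -/
def IsIrreducible (δ : Derivation ℂ B B) : Prop :=
  ∀ b : B, Set.range δ ⊆ (Ideal.span {b} : Ideal B) → IsUnit b

/-- The kernel of a derivation, as a `ℂ`-subalgebra of `B`. For a locally nilpotent `δ` this is
the ring of invariants of the corresponding `G_a`-action, and the quotient morphism is
`Spec B → Spec (ker δ)` given by the inclusion. -/
def ker (δ : Derivation ℂ B B) : Subalgebra ℂ B where
  carrier := {b | δ b = 0}
  mul_mem' := by
    intro a b (ha : δ a = 0) (hb : δ b = 0)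
    change δ (a * b) = 0
    simp [ha, hb]
  add_mem' := by
    intro a b (ha : δ a = 0) (hb : δ b = 0)
    change δ (a + b) = 0
    simp [ha, hb]
  algebraMap_mem' := fun r => δ.map_algebraMap r

theorem mem_ker {δ : Derivation ℂ B B} {b : B} : b ∈ ker δ ↔ δ b = 0 := Iff.rfl

theorem map_span_le (δ : Derivation ℂ B B) (f : ker δ) :
    (Ideal.span {(f : B)}).restrictScalars ℂ ≤
      ((Ideal.span {(f : B)}).restrictScalars ℂ).comap (δ : B →ₗ[ℂ] B) := by
  intro x hx
  have hf : δ (f : B) = 0 := f.2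
  obtain ⟨c, rfl⟩ := Ideal.mem_span_singleton'.1 hx
  refine Ideal.mem_span_singleton'.2 ⟨δ c, ?_⟩
  change δ c * f = δ (c * f)
  simp [hf, mul_comm]

/-- For `f ∈ ker δ`, the derivation of `B / fB` induced by `δ`, that is,
`(b mod f) ↦ (δ b mod f)`. -/
def induced (δ : Derivation ℂ B B) (f : ker δ) :
    Derivation ℂ (B ⧸ Ideal.span {(f : B)}) (B ⧸ Ideal.span {(f : B)}) :=
  Derivation.mk'
    (Submodule.mapQ ((Ideal.span {(f : B)}).restrictScalars ℂ)
      ((Ideal.span {(f : B)}).restrictScalars ℂ) (δ : B →ₗ[ℂ] B) (map_span_le δ f))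
    (by
      intro a b
      obtain ⟨a, rfl⟩ := Ideal.Quotient.mk_surjective a
      obtain ⟨b, rfl⟩ := Ideal.Quotient.mk_surjective b
      change Ideal.Quotient.mk (Ideal.span {(f : B)}) (δ (a * b)) =
        Ideal.Quotient.mk (Ideal.span {(f : B)}) a * Ideal.Quotient.mk (Ideal.span {(f : B)}) (δ b)
        + Ideal.Quotient.mk (Ideal.span {(f : B)}) b * Ideal.Quotient.mk (Ideal.span {(f : B)}) (δ a)
      rw [← map_mul, ← map_mul, ← map_add, δ.leibniz]
      rfl)

@[simp]
theorem induced_mk (δ : Derivation ℂ B B) (f : ker δ) (b : B) :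
    induced δ f (Ideal.Quotient.mk _ b) = Ideal.Quotient.mk _ (δ b) := rfl

/-- The homomorphism `A / fA → ker δ_f`, `a mod f ↦ a mod f`, where `A = ker δ`, `f ∈ A`, and `δ_f`
is the derivation of `B / fB` induced by `δ`. -/
def toKerInduced (δ : Derivation ℂ B B) (f : ker δ) :
    (ker δ ⧸ Ideal.span {f}) →ₐ[ℂ] ker (induced δ f) :=
  (Ideal.quotientMapₐ (Ideal.span {(f : B)}) (ker δ).val
    ((Ideal.span_singleton_le_iff_mem _).2 (Ideal.mem_span_singleton_self (f : B)))).codRestrict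
    (ker (induced δ f)) (by
      intro a
      obtain ⟨a, rfl⟩ := Ideal.Quotient.mk_surjective a
      have ha : δ (a : B) = 0 := a.2
      change Ideal.Quotient.mk (Ideal.span {(f : B)}) (δ (a : B)) = 0
      rw [ha, map_zero])

@[simp]
theorem coe_toKerInduced_mk (δ : Derivation ℂ B B) (f a : ker δ) :
    (toKerInduced δ f (Ideal.Quotient.mk _ a) : B ⧸ Ideal.span {(f : B)}) =
      Ideal.Quotient.mk _ (a : B) := rfl

end Derivations

/-- The morphism of integral affine schemes `Spec S → Spec R` given by `φ : R → S` is birational: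
`S` (hence `R`) is a domain, `φ` is injective (the morphism is dominant), and `φ` induces an
isomorphism of function fields `Q(R) ≅ Q(S)`. -/
def IsBirational {R : Type u} {S : Type v} [CommRing R] [CommRing S] (φ : R →+* S) : Prop :=
  ∃ (_ : IsDomain S) (hφ : Function.Injective φ),
    Function.Bijective
      (IsFractionRing.map (K := FractionRing R) (L := FractionRing S) hφ)

section Fibrations

variable (A : Type u) (B : Type v) [CommRing A] [CommRing B] [Algebra A B]

/-- `Spec B → Spec A` is a trivial `𝔸¹`-bundle: `Spec B ≅ Spec A × 𝔸¹` over `Spec A`. -/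
def IsTrivialA1Bundle : Prop :=
  Nonempty (B ≃ₐ[A] A[X])

/-- The scheme-theoretic fiber `Spec (B / 𝔪B)` of `Spec B → Spec A` over the closed point `𝔪` is
isomorphic to the complex affine line. -/
def FiberIsA1 [Algebra ℂ B] (𝔪 : Ideal A) : Prop :=
  Nonempty ((B ⧸ 𝔪.map (algebraMap A B)) ≃ₐ[ℂ] ℂ[X])

end Fibrations

end GaQuotient

/-!
Write `A = ker δ`.

A slice `s` of `δ`, that is, `δ s = 1`, makes `B` a polynomial ring `A[s]`
(`GaQuotient.isTrivialA1Bundle_of_slice`), so the fibre and birationality conditions have to produce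
a slice. The local nilpotency of `δ` gives `r` with `0 ≠ δ r ∈ A`, and all prime factors of `δ r` in
`B` lie in `A`, because `A` is factorially closed. A prime factor `p` of `δ r` can be cancelled as
soon as `r` is congruent modulo `pB` to some `u ∈ A`: then `r = u + p s` and `δ s = δ r / p`.
Cancelling all of them yields a slice (`GaQuotient.exists_slice`).

The class of `r` in `B / pB` has zero derivative. By faithful flatness it is enough that it lies in
the fraction field of `A / pA` (`GaQuotient.exists_dvd_sub_of_dvd_mul_sub`). If `p` divides `α`,
this is birationality of `A / pA → ker δ_p`. If not, the fibres over the general closed points of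
`V(p)` are affine lines on which `δ` is a nonzero multiple of `d/dx`, so `r` is constant on each of
them, and a function that is constant on general closed fibres comes, in characteristic zero, from
the function field of the base (`GaQuotient.exists_mul_eq_algebraMap_of_forall_isMaximal`). The last
fact is seen on the fibre product: `r ⊗ 1 - 1 ⊗ r` vanishes at enough closed points to be nilpotent
over the generic point, which forces `r ⊗ 1 = 1 ⊗ r` there
(`GaQuotient.mem_range_of_isNilpotent_tmul_sub_tmul`).

Conversely, if `B = A[x]`, irreducibility makes `δ` a unit multiple of `d/dx`. All closed fibres are
affine lines and `A / fA = ker δ_f` for every prime `f` of `A`, so any nonzero nonunit `α` of `A`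
serves; one exists because `dim A = dim B - 1 ≥ 1`, and Krull's theorem gives its height.
-/

namespace GaQuotient

/-! ### Generic descent of a function that is constant on closed fibres -/

section Descent

open scoped TensorProduct

open scoped IntermediateField in
/-- In characteristic zero, `r ⊗ 1 - 1 ⊗ r` is nilpotent in `L ⊗[K] L` only if `r ∈ K`. The binomial
expansion of a vanishing power is a linear relation between the `rⁱ ⊗ rʲ`, so `r` is algebraic;
then `K(r) ⊗[K] K(r)` is reduced because `K(r)` is separable, hence `r ⊗ 1 = 1 ⊗ r`. -/
theorem mem_range_of_isNilpotent_tmul_sub_tmul {K L : Type*} [Field K] [CharZero K] [Field L]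
    [Algebra K L] {r : L}
    (h : IsNilpotent (r ⊗ₜ[K] (1 : L) - (1 : L) ⊗ₜ[K] r)) : r ∈ Set.range (algebraMap K L) := by
  have halg : IsAlgebraic K r := by
    by_contra htr
    have hli : LinearIndependent K (fun i : ℕ => r ^ i) := by
      have := (transcendental_iff_injective.1 htr)
      have hpow : (fun i : ℕ => r ^ i) = (aeval r).toLinearMap ∘ Polynomial.basisMonomials K := by
        ext i
        simp
      rw [hpow]
      exact (Polynomial.basisMonomials K).linearIndependent.map'
        (aeval r).toLinearMap (LinearMap.ker_eq_bot.2 this)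
    have hli2 := hli.tmul_of_flat_left hli
    obtain ⟨n, hn⟩ := h
    rw [sub_eq_add_neg, (Commute.all _ _).add_pow] at hn
    have h3 : ∑ m ∈ Finset.range (n + 1), ((-1) ^ (n - m) * (n.choose m : K)) •
        ((r ^ m) ⊗ₜ[K] (r ^ (n - m))) = 0 := by
      rw [← hn]
      refine Finset.sum_congr rfl fun m _ => ?_
      rw [neg_pow ((1 : L) ⊗ₜ[K] r), Algebra.TensorProduct.tmul_pow,
        Algebra.TensorProduct.tmul_pow, Algebra.smul_def]
      simp only [one_pow, map_mul, map_pow, map_neg, map_one, map_natCast]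
      rw [mul_left_comm, Algebra.TensorProduct.tmul_mul_tmul, one_mul, mul_one]
      ring
    -- The coefficient of `rⁿ ⊗ 1` in the expansion is `1`.
    have h4 := linearIndependent_iff'.1 (hli2.comp (fun m : ℕ => (m, n - m))
      (fun a b hab => congrArg Prod.fst hab)) (Finset.range (n + 1))
      (fun m => (-1) ^ (n - m) * (n.choose m : K)) h3 n (Finset.self_mem_range_succ n)
    simp at h4
  have hint : IsIntegral K r := halg.isIntegral
  let E := K⟮r⟯
  have : FiniteDimensional K E := IntermediateField.adjoin.finiteDimensional hint
  have : Algebra.FormallyUnramified K E := Algebra.FormallyUnramified.of_isSeparable K E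
  have : IsReduced (E ⊗[K] E) := Algebra.FormallyUnramified.isReduced_of_field E (E ⊗[K] E)
  let g : E := IntermediateField.AdjoinSimple.gen K r
  have hinj : Function.Injective (Algebra.TensorProduct.map E.val E.val) :=
    TensorProduct.map_injective_of_flat_flat _ _ E.val.injective E.val.injective
  have hg : IsNilpotent (g ⊗ₜ[K] (1 : E) - (1 : E) ⊗ₜ[K] g) := by
    refine (IsNilpotent.map_iff (f := (Algebra.TensorProduct.map E.val E.val)) hinj).1 ?_
    have hgr : E.val g = r := IntermediateField.AdjoinSimple.algebraMap_gen K r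
    rwa [map_sub, Algebra.TensorProduct.map_tmul, Algebra.TensorProduct.map_tmul, map_one, hgr]
  have hg0 := hg.eq_zero
  have : g ∈ Set.range (algebraMap K E) := by
    rw [← Algebra.IsEffective.eqLocus_includeLeft_includeRight
      (Algebra.IsEffective.of_faithfullyFlat K E)]
    exact sub_eq_zero.1 hg0
  obtain ⟨k, hk⟩ := this
  refine ⟨k, ?_⟩
  have := congrArg E.val hk
  simpa [g] using this

/-- Closed points map to closed points under a morphism of finite type to a Jacobson scheme. -/
theorem isMaximal_comap_algebraMap {R T : Type*} [CommRing R] [IsJacobsonRing R] [CommRing T]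
    [Algebra R T] [Algebra.FiniteType R T] (M : Ideal T) [hM : M.IsMaximal] :
    (M.comap (algebraMap R T)).IsMaximal := by
  let := Ideal.Quotient.field M
  have : Module.Finite R (T ⧸ M) := finite_of_finite_type_of_isJacobsonRing R (T ⧸ M)
  have := Ideal.isMaximal_comap_of_isIntegral_of_isMaximal (R := R) (S := T ⧸ M) ⊥
  convert this using 1
  ext x
  simp only [Ideal.mem_comap, Ideal.mem_bot]
  rw [IsScalarTower.algebraMap_apply R T (T ⧸ M), Ideal.Quotient.algebraMap_eq,
    Ideal.Quotient.eq_zero_iff_mem]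

/-- If the restriction of `r` to the closed fibres of `Spec S → Spec R` is constant, at least on the
fibres where `g` does not vanish identically, then `r` lies in the fraction field of `R`. On
`Spec (S ⊗[R] S)` the function `(g ⊗ 1) * (r ⊗ 1 - 1 ⊗ r)` vanishes at all closed points, hence is
nilpotent, and `g` is invertible in the fraction field of `S`. -/
theorem exists_mul_eq_algebraMap_of_forall_isMaximal {R S : Type*} [CommRing R] [IsDomain R]
    [CharZero R] [IsJacobsonRing R] [CommRing S] [IsDomain S] [Algebra R S]
    [Algebra.FiniteType R S] (hinj : Function.Injective (algebraMap R S)) {g r : S} (hg : g ≠ 0)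
    (h : ∀ 𝔪 : Ideal R, 𝔪.IsMaximal → g ∉ 𝔪.map (algebraMap R S) →
      ∃ a : R, r - algebraMap R S a ∈ 𝔪.map (algebraMap R S)) :
    ∃ d a : R, d ≠ 0 ∧ algebraMap R S d * r = algebraMap R S a := by
  let z : S ⊗[R] S := r ⊗ₜ[R] (1 : S) - (1 : S) ⊗ₜ[R] r
  have : Algebra.FiniteType R (S ⊗[R] S) := Algebra.FiniteType.trans (S := S) ‹_› inferInstance
  have : IsJacobsonRing (S ⊗[R] S) := isJacobsonRing_of_finiteType (A := R)
  have hmax : ∀ M : Ideal (S ⊗[R] S), M.IsMaximal → (g ⊗ₜ[R] (1 : S)) * z ∈ M := by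
    intro M hM
    set 𝔪 := M.comap (algebraMap R (S ⊗[R] S)) with h𝔪
    have hm : 𝔪.IsMaximal := isMaximal_comap_algebraMap M
    have hleft : 𝔪.map (algebraMap R S) ≤
        M.comap (Algebra.TensorProduct.includeLeft : S →ₐ[R] S ⊗[R] S) := by
      rw [Ideal.map_le_iff_le_comap]
      intro a ha
      simpa [h𝔪, Algebra.TensorProduct.algebraMap_apply] using ha
    have hright : 𝔪.map (algebraMap R S) ≤
        M.comap (Algebra.TensorProduct.includeRight : S →ₐ[R] S ⊗[R] S) := by
      rw [Ideal.map_le_iff_le_comap]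
      intro a ha
      rw [Ideal.mem_comap, Ideal.mem_comap, AlgHom.commutes]
      exact ha
    -- If `g` vanishes on the fibre, so does the first factor; otherwise `r` is constant on it.
    by_cases hgm : g ∈ 𝔪.map (algebraMap R S)
    · exact M.mul_mem_right _ (hleft hgm)
    · obtain ⟨a, ha⟩ := h 𝔪 hm hgm
      refine M.mul_mem_left _ ?_
      have h1 := hleft ha
      have h2 := hright ha
      rw [Ideal.mem_comap, map_sub, AlgHom.commutes] at h1 h2
      have h3 := M.sub_mem h1 h2
      rwa [sub_sub_sub_cancel_right] at h3
  have hnil : IsNilpotent ((g ⊗ₜ[R] (1 : S)) * z) := by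
    have hr : (nilradical (S ⊗[R] S)).jacobson = nilradical (S ⊗[R] S) :=
      IsJacobsonRing.out inferInstance (Ideal.radical_isRadical _)
    rw [← mem_nilradical, ← hr, Ideal.jacobson, Ideal.mem_sInf]
    intro M hM
    exact hmax M hM.2
  let K := FractionRing R
  let L := FractionRing S
  let : Algebra K L := (IsFractionRing.map (K := K) (L := L) hinj).toAlgebra
  have : IsScalarTower R K L := IsScalarTower.of_algebraMap_eq fun x => by
    rw [RingHom.algebraMap_toAlgebra (IsFractionRing.map (K := K) (L := L) hinj),
      IsFractionRing.map, IsLocalization.map_eq, ← IsScalarTower.algebraMap_apply]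
  have : CharZero K := charZero_of_injective_algebraMap (IsFractionRing.injective R K)
  let ι : S →ₐ[R] L := IsScalarTower.toAlgHom R S L
  let Φ : S ⊗[R] S →ₐ[R] L ⊗[K] L := Algebra.TensorProduct.productMap
    (((Algebra.TensorProduct.includeLeft : L →ₐ[K] L ⊗[K] L).restrictScalars R).comp ι)
    (((Algebra.TensorProduct.includeRight : L →ₐ[K] L ⊗[K] L).restrictScalars R).comp ι)
  have hnil' := hnil.map Φ
  have hu : IsUnit (Φ (g ⊗ₜ[R] (1 : S))) := by
    have : IsUnit (ι g) :=
      (map_ne_zero_iff (ι : S →+* L) (IsFractionRing.injective S L)).2 hg |>.isUnit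
    have h2 := this.map (Algebra.TensorProduct.includeLeft : L →ₐ[K] L ⊗[K] L)
    simpa [Φ] using h2
  rw [map_mul] at hnil'
  have hnz : IsNilpotent (Φ z) := by
    obtain ⟨n, hn⟩ := hnil'
    rw [mul_pow] at hn
    exact ⟨n, (hu.pow n).mul_right_eq_zero.1 hn⟩
  have hz : Φ z = (ι r) ⊗ₜ[K] (1 : L) - (1 : L) ⊗ₜ[K] (ι r) := by simp [Φ, z]
  rw [hz] at hnz
  obtain ⟨k, hk⟩ := mem_range_of_isNilpotent_tmul_sub_tmul hnz
  obtain ⟨a, d, hd, rfl⟩ := IsFractionRing.div_surjective (A := R) k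
  refine ⟨d, a, nonZeroDivisors.ne_zero hd, ?_⟩
  apply IsFractionRing.injective S L
  have hd0 : algebraMap R L d ≠ 0 := by
    rw [IsScalarTower.algebraMap_apply R K L]
    exact (_root_.map_ne_zero _).2 ((map_ne_zero_iff _ (IsFractionRing.injective R K)).2
      (nonZeroDivisors.ne_zero hd))
  rw [map_mul, ← IsScalarTower.algebraMap_apply, ← IsScalarTower.algebraMap_apply]
  change _ * ι r = _
  rw [← hk, map_div₀, ← IsScalarTower.algebraMap_apply, ← IsScalarTower.algebraMap_apply,
    mul_div_cancel₀ _ hd0]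

end Descent

/-! ### The kernel of a locally nilpotent derivation -/

section Kernel

variable {B : Type*} [CommRing B] [Algebra ℂ B] {δ : Derivation ℂ B B}

theorem map_coe_mul (a : ker δ) (b : B) : δ ((a : B) * b) = a * δ b := by
  have ha : δ (a : B) = 0 := a.2
  simp [ha]

theorem iterate_coe_mul (a : ker δ) (b : B) (n : ℕ) : (δ^[n]) ((a : B) * b) = a * (δ^[n]) b := by
  induction n generalizing b with
  | zero => rfl
  | succ n ih => rw [Function.iterate_succ_apply, Function.iterate_succ_apply, map_coe_mul, ih]

/-- The leading term of the Leibniz formula: if `δⁿ a` and `δᵐ b` are the last iterates that may be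
nonzero, all terms of `δⁿ⁺ᵐ (a b)` but one vanish. -/
theorem iterate_mul_eq_choose_mul {a b : B} {n m : ℕ} (ha : (δ^[n + 1]) a = 0)
    (hb : (δ^[m + 1]) b = 0) :
    (δ^[n + m]) (a * b) = ((n + m).choose n : B) * ((δ^[n]) a * (δ^[m]) b) := by
  induction h : n + m generalizing n m a b with
  | zero =>
    obtain ⟨rfl, rfl⟩ : n = 0 ∧ m = 0 := by omega
    simp
  | succ k ih =>
    rcases n with _ | n
    · obtain rfl : m = k + 1 := by omega
      simpa using iterate_coe_mul ⟨a, ha⟩ b (k + 1)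
    rcases m with _ | m
    · obtain rfl : n = k := by omega
      have := iterate_coe_mul ⟨b, hb⟩ a (n + 1)
      rw [mul_comm a b, this]
      simp [mul_comm]
    rw [Function.iterate_succ_apply, δ.leibniz, smul_eq_mul, smul_eq_mul, iterate_map_add,
      ih (n := n + 1) (m := m) ha (b := δ b) hb (by omega), mul_comm b,
      ih (n := n) (m := m + 1) (a := δ a) ha hb (by omega), Nat.choose_succ_succ,
      Function.iterate_succ_apply δ m b, Function.iterate_succ_apply δ n a, Nat.cast_add]
    ring

theorem exists_iterate_ne_zero (hnil : IsLocallyNilpotent δ) {b : B} (hb : b ≠ 0) :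
    ∃ n, (δ^[n]) b ≠ 0 ∧ (δ^[n + 1]) b = 0 := by
  classical
  obtain ⟨n, hn⟩ : ∃ n, Nat.find (hnil b) = n + 1 :=
    Nat.exists_eq_succ_of_ne_zero fun h => hb ((Nat.find_eq_zero (hnil b)).1 h)
  exact ⟨n, Nat.find_min (hnil b) (by omega), hn ▸ Nat.find_spec (hnil b)⟩

/-- A nonzero locally nilpotent derivation has a local slice. -/
theorem exists_map_mem_ker (hnil : IsLocallyNilpotent δ) {b : B} (hb : δ b ≠ 0) :
    ∃ r, δ r ∈ ker δ ∧ δ r ≠ 0 := by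
  obtain ⟨n, hn, hn'⟩ := exists_iterate_ne_zero hnil hb
  refine ⟨(δ^[n]) b, ?_, ?_⟩
  · rw [mem_ker, ← Function.iterate_succ_apply' δ, ← Function.iterate_succ_apply' δ,
      Function.iterate_succ_apply]
    exact hn'
  · rwa [← Function.iterate_succ_apply' δ, Function.iterate_succ_apply]

/-- The kernel of a locally nilpotent derivation of a domain of characteristic zero is factorially
closed. -/
theorem left_mem_ker_of_mul_mem_ker [IsDomain B] (hnil : IsLocallyNilpotent δ) {a b : B}
    (hab : a * b ≠ 0) (h : a * b ∈ ker δ) : a ∈ ker δ := by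
  have : CharZero B := Algebra.charZero_of_charZero ℂ B
  obtain ⟨n, hn, hn'⟩ := exists_iterate_ne_zero hnil (left_ne_zero_of_mul hab)
  obtain ⟨m, hm, hm'⟩ := exists_iterate_ne_zero hnil (right_ne_zero_of_mul hab)
  rcases n with _ | n
  · exact hn'
  have h1 := iterate_mul_eq_choose_mul hn' hm'
  rw [show n + 1 + m = (n + m) + 1 by omega, Function.iterate_succ_apply, mem_ker.1 h,
    iterate_map_zero] at h1
  exact absurd h1.symm (mul_ne_zero (Nat.cast_ne_zero.2 (Nat.choose_pos (by omega)).ne')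
    (mul_ne_zero hn hm))

theorem right_mem_ker_of_mul_mem_ker [IsDomain B] (hnil : IsLocallyNilpotent δ) {a b : B}
    (hab : a * b ≠ 0) (h : a * b ∈ ker δ) : b ∈ ker δ := by
  rw [mul_comm] at hab h
  exact left_mem_ker_of_mul_mem_ker hnil hab h

/-- Faithful flatness over `A = ker δ`: `IB ∩ A = I` for every ideal `I` of `A`. -/
theorem mem_of_coe_mem_map [Module.FaithfullyFlat (ker δ) B] {I : Ideal (ker δ)} {a : ker δ}
    (h : (a : B) ∈ I.map (algebraMap (ker δ) B)) : a ∈ I := by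
  rw [← Ideal.comap_map_eq_self_of_faithfullyFlat (B := B) I]
  exact h

theorem dvd_of_coe_dvd_coe [Module.FaithfullyFlat (ker δ) B] {a b : ker δ}
    (h : (a : B) ∣ b) : a ∣ b := by
  rw [← Ideal.mem_span_singleton]
  refine mem_of_coe_mem_map ?_
  rw [Ideal.map_span, Set.image_singleton]
  exact Ideal.mem_span_singleton.2 h

/-- An element of `B / pB` that is a fraction of elements of `A / pA`, where `A = ker δ`, belongs to
`A / pA`. Here `a ∈ (d, p)B ∩ A = (d, p)A` gives the element of `A`. -/
theorem exists_dvd_sub_of_dvd_mul_sub [Module.FaithfullyFlat (ker δ) B] {p d a : ker δ}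
    (hp : Prime (p : B)) (hd : ¬ p ∣ d) {r : B} (h : (p : B) ∣ d * r - a) :
    ∃ u : ker δ, (p : B) ∣ r - u := by
  have hmem : a ∈ Ideal.span {d, p} := by
    refine mem_of_coe_mem_map ?_
    obtain ⟨c, hc⟩ := h
    rw [Ideal.map_span, Set.image_pair]
    refine Ideal.mem_span_pair.2 ⟨r, -c, ?_⟩
    change r * (d : B) + -c * (p : B) = a
    linear_combination hc
  obtain ⟨u, v, huv⟩ := Ideal.mem_span_pair.1 hmem
  refine ⟨u, (hp.dvd_or_dvd (a := (d : B)) ?_).resolve_left fun h' => hd (dvd_of_coe_dvd_coe h')⟩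
  have h1 : (d : B) * (r - u) = (d * r - a) + p * v := by
    rw [← huv]
    push_cast
    ring
  rw [h1]
  exact dvd_add h (dvd_mul_right _ _)

end Kernel

/-! ### Slices -/

section Slice

variable {B : Type*} [CommRing B] [Algebra ℂ B] {δ : Derivation ℂ B B}

theorem map_aeval_ker (s : B) (P : (ker δ)[X]) :
    δ (aeval s P) = aeval s (derivative P) * δ s := by
  induction P using Polynomial.induction_on' with
  | add p q hp hq => simp only [map_add, hp, hq, add_mul]
  | monomial n a =>
    rw [aeval_monomial]
    change δ ((a : B) * s ^ n) = _
    rw [map_coe_mul, δ.leibniz_pow, derivative_monomial, aeval_monomial]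
    change _ = ((a * n : ker δ) : B) * s ^ (n - 1) * δ s
    push_cast
    simp only [nsmul_eq_mul, smul_eq_mul]
    ring

theorem exists_derivative_eq {R : Type*} [CommRing R] [Algebra ℂ R] (P : R[X]) :
    ∃ Q : R[X], derivative Q = P := by
  induction P using Polynomial.induction_on' with
  | add p q hp hq =>
    obtain ⟨p', rfl⟩ := hp
    obtain ⟨q', rfl⟩ := hq
    exact ⟨p' + q', derivative_add⟩
  | monomial n a =>
    refine ⟨monomial (n + 1) (algebraMap ℂ R ((n : ℂ) + 1)⁻¹ * a), ?_⟩
    rw [derivative_monomial, Nat.add_sub_cancel]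
    congr 1
    have h : ((n : ℂ) + 1)⁻¹ * ((n : ℂ) + 1) = 1 :=
      inv_mul_cancel₀ (by exact_mod_cast Nat.succ_ne_zero n)
    have h2 := congrArg (algebraMap ℂ R) h
    simp only [map_mul, map_add, map_natCast, map_one] at h2
    push_cast
    linear_combination a * h2

/-- If `δ s = 1`, then `s` is a coordinate of `B` over `ker δ`. Both halves of the bijectivity of
`P ↦ P(s)` are inductions that use `δ (P(s)) = P'(s)`: on the degree of `P` for injectivity, and on
the order of nilpotency, integrating polynomials, for surjectivity. -/
theorem isTrivialA1Bundle_of_slice [IsDomain B] (hnil : IsLocallyNilpotent δ) {s : B}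
    (hs : δ s = 1) : IsTrivialA1Bundle (ker δ) B := by
  have : CharZero B := Algebra.charZero_of_charZero ℂ B
  have : CharZero (ker δ) := (ker δ).val.toRingHom.charZero
  refine ⟨(AlgEquiv.ofBijective (aeval s : (ker δ)[X] →ₐ[ker δ] B) ⟨?_, ?_⟩).symm⟩
  · rw [injective_iff_map_eq_zero]
    intro P
    induction h : P.natDegree using Nat.strong_induction_on generalizing P with
    | _ n ih =>
      intro hP
      by_cases hn : n = 0
      · subst hn
        obtain ⟨a, rfl⟩ := natDegree_eq_zero.1 h
        rw [aeval_C] at hP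
        rw [show a = 0 from Subtype.ext hP, C_0]
      · have hd : derivative P = 0 := by
          refine ih _ (h ▸ natDegree_derivative_lt (h ▸ hn)) _ rfl ?_
          have := map_aeval_ker (δ := δ) s P
          rwa [hP, map_zero, hs, mul_one, eq_comm] at this
        exact absurd (h ▸ derivative_eq_zero.1 hd) hn
  · intro b
    obtain ⟨n, hn⟩ := hnil b
    induction n generalizing b with
    | zero => exact ⟨0, by rw [map_zero]; exact hn.symm⟩
    | succ n ih =>
      obtain ⟨P, hP⟩ := ih (δ b) hn
      obtain ⟨Q, rfl⟩ := exists_derivative_eq P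
      have h0 : δ (b - aeval s Q) = 0 := by rw [map_sub, map_aeval_ker, hs, mul_one, hP, sub_self]
      refine ⟨Q + C ⟨b - aeval s Q, h0⟩, ?_⟩
      rw [map_add, aeval_C]
      exact add_sub_cancel _ _

/-- If modulo every prime `p ∈ ker δ` of `B` the elements with zero derivative come from `ker δ`,
then `δ` has a slice. The prime factors of `δ r ∈ ker δ` can be removed one at a time: if
`δ r = p x` and `r = u + p s` with `u ∈ ker δ`, then `δ s = x`. -/
theorem exists_slice [IsDomain B] [UniqueFactorizationMonoid B] [Module.FaithfullyFlat (ker δ) B]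
    (hnil : IsLocallyNilpotent δ) (hne : ∃ b, δ b ≠ 0)
    (hkey : ∀ p : ker δ, Prime (p : B) → ∀ r : B, (p : B) ∣ δ r → ∃ u : ker δ, (p : B) ∣ r - u) :
    ∃ s, δ s = 1 := by
  obtain ⟨b, hb⟩ := hne
  obtain ⟨r, hr, hr0⟩ := exists_map_mem_ker hnil hb
  -- Induction on the prime factors in `B` of the derivative of a local slice.
  suffices ∀ h : B, h ≠ 0 → h ∈ ker δ → (∃ r, δ r = h) → ∃ s, δ s = 1 from
    this (δ r) hr0 hr ⟨r, rfl⟩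
  intro h
  induction h using UniqueFactorizationMonoid.induction_on_prime with
  | h₁ => exact fun h => absurd rfl h
  | h₂ x hx =>
    rintro - hxk ⟨r, hr⟩
    obtain ⟨y, hxy⟩ := hx.exists_left_inv
    have hy : y ∈ ker δ := left_mem_ker_of_mul_mem_ker hnil (hxy ▸ one_ne_zero)
      (hxy ▸ (ker δ).one_mem)
    exact ⟨y * r, by rw [map_coe_mul ⟨y, hy⟩, hr, hxy]⟩
  | h₃ x p hx hp ih =>
    rintro hpx hpxk ⟨r, hr⟩
    have hpk := left_mem_ker_of_mul_mem_ker hnil hpx hpxk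
    have hxk := right_mem_ker_of_mul_mem_ker hnil hpx hpxk
    obtain ⟨u, s, hs⟩ := hkey ⟨p, hpk⟩ hp r ⟨x, hr⟩
    refine ih hx hxk ⟨s, mul_left_cancel₀ hp.ne_zero ?_⟩
    have h1 : δ (p * s) = p * δ s := map_coe_mul ⟨p, hpk⟩ s
    have hu : δ (u : B) = 0 := u.2
    rw [← h1, ← hr]
    change r - u = p * s at hs
    rw [← hs, map_sub, hu, sub_zero]

end Slice

/-! ### Constants of the derivation modulo a prime of the kernel -/

section Constants

variable {B : Type*} [CommRing B] [Algebra ℂ B] {δ : Derivation ℂ B B}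

/-- If `φ : R → S` induces an isomorphism of fraction fields, every element of `S` is a fraction of
elements of `R`. -/
theorem IsBirational.exists_mul_eq {R S : Type*} [CommRing R] [CommRing S] {φ : R →+* S}
    (h : IsBirational φ) (x : S) : ∃ d a : R, d ≠ 0 ∧ φ d * x = φ a := by
  obtain ⟨hdom, hinj, hbij⟩ := h
  have : IsDomain R := hinj.isDomain _
  obtain ⟨k, hk⟩ := hbij.2 (algebraMap _ _ x)
  obtain ⟨a, d, hd, rfl⟩ := IsFractionRing.div_surjective (A := R) k
  have hd0 := nonZeroDivisors.ne_zero hd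
  have hφd : φ d ≠ 0 := (map_ne_zero_iff _ hinj).2 hd0
  rw [map_div₀, IsFractionRing.map, IsLocalization.map_eq, IsLocalization.map_eq,
    div_eq_iff ((map_ne_zero_iff _ (IsFractionRing.injective _ _)).2 hφd), ← map_mul] at hk
  exact ⟨d, a, hd0, by rw [mul_comm, ← IsFractionRing.injective _ _ hk]⟩

theorem exists_dvd_mul_sub_of_isBirational {p : ker δ}
    (h : IsBirational (toKerInduced δ p).toRingHom)
    {r : B} (hr : (p : B) ∣ δ r) : ∃ d a : ker δ, ¬ p ∣ d ∧ (p : B) ∣ d * r - a := by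
  let x : ker (induced δ p) := ⟨Ideal.Quotient.mk _ r, by
    rw [mem_ker, induced_mk, Ideal.Quotient.eq_zero_iff_mem, Ideal.mem_span_singleton]
    exact hr⟩
  obtain ⟨d, a, hd0, hda⟩ := h.exists_mul_eq x
  obtain ⟨a, rfl⟩ := Ideal.Quotient.mk_surjective a
  obtain ⟨d, rfl⟩ := Ideal.Quotient.mk_surjective d
  refine ⟨d, a, fun hpd => hd0 ?_, ?_⟩
  · rwa [Ideal.Quotient.eq_zero_iff_mem, Ideal.mem_span_singleton]
  · have h2 := congrArg Subtype.val hda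
    change Ideal.Quotient.mk (Ideal.span {(p : B)}) (d : B) * Ideal.Quotient.mk _ r =
      Ideal.Quotient.mk _ (a : B) at h2
    rwa [← map_mul, Ideal.Quotient.eq, Ideal.mem_span_singleton] at h2

/-- On a closed fibre isomorphic to `𝔸¹`, a derivation of `B` that is nonzero there induces a
nonzero multiple of `d/dx` on `ℂ[x]`, so only scalars have zero derivative. -/
theorem exists_sub_algebraMap_mem_of_fiberIsA1 {𝔪 : Ideal (ker δ)}
    (h : FiberIsA1 (ker δ) B 𝔪) {b r : B}
    (hb : δ b ∉ 𝔪.map (algebraMap (ker δ) B)) (hr : δ r ∈ 𝔪.map (algebraMap (ker δ) B)) :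
    ∃ c : ℂ, r - algebraMap ℂ B c ∈ 𝔪.map (algebraMap (ker δ) B) := by
  obtain ⟨e⟩ := h
  set J := 𝔪.map (algebraMap (ker δ) B)
  let φ : B →ₐ[ℂ] ℂ[X] := (e : (B ⧸ J) →ₐ[ℂ] ℂ[X]).comp (Ideal.Quotient.mkₐ ℂ J)
  have hφ : ∀ x, φ x = 0 ↔ x ∈ J := fun x =>
    (map_eq_zero_iff _ e.injective).trans Ideal.Quotient.eq_zero_iff_mem
  have hφs : Function.Surjective φ := e.surjective.comp Ideal.Quotient.mk_surjective
  have hstab : ∀ x ∈ J, δ x ∈ J := by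
    intro x hx
    refine Submodule.span_induction ?_ ?_ ?_ ?_ hx
    · rintro _ ⟨a, -, rfl⟩
      have : δ (algebraMap (ker δ) B a) = 0 := a.2
      rw [this]
      exact J.zero_mem
    · rw [map_zero]
      exact J.zero_mem
    · intro x y _ _ hx hy
      rw [map_add]
      exact J.add_mem hx hy
    · intro b x hx hδx
      rw [smul_eq_mul, δ.leibniz]
      exact J.add_mem (J.mul_mem_left b hδx) (J.mul_mem_right (δ b) hx)
  obtain ⟨t, ht⟩ := hφs X
  have hder : ∀ x, φ (δ x) = derivative (φ x) * φ (δ t) := by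
    intro x
    have h1 : x - aeval t (φ x) ∈ J := by
      rw [← hφ, map_sub, ← aeval_algHom_apply, ht, aeval_X_left_apply, sub_self]
    have h2 := hstab _ h1
    rw [map_sub, ← hφ, map_sub, sub_eq_zero, Derivation.map_aeval, smul_eq_mul, map_mul,
      ← aeval_algHom_apply, ht, aeval_X_left_apply] at h2
    exact h2
  have hbt : φ (δ t) ≠ 0 := by
    intro h0
    refine hb ((hφ _).1 ?_)
    rw [hder, h0, mul_zero]
  have hr' := (hφ _).2 hr
  rw [hder] at hr'
  have hd := (mul_eq_zero.1 hr').resolve_right hbt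
  refine ⟨(φ r).coeff 0, (hφ _).1 ?_⟩
  rw [map_sub, AlgHom.commutes, sub_eq_zero]
  exact eq_C_of_derivative_eq_zero hd

/-- Away from `V(α)`, an element of `B / pB` with zero derivative is a fraction of elements of
`A / pA`, where `A = ker δ`. By irreducibility some `δ b` is nonzero modulo `p`; on the closed
fibres over `V(p)` where `α * δ b` does not vanish identically, the element is constant. -/
theorem exists_dvd_mul_sub_of_forall_fiberIsA1 [Algebra.FiniteType ℂ B]
    [Algebra.FiniteType ℂ (ker δ)] [Module.FaithfullyFlat (ker δ) B] (hirr : IsIrreducible δ)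
    {p α : ker δ} (hp : Prime (p : B)) (hα : ¬ p ∣ α)
    (hfib : ∀ 𝔪 : Ideal (ker δ), 𝔪.IsMaximal → α ∉ 𝔪 → FiberIsA1 (ker δ) B 𝔪)
    {r : B} (hr : (p : B) ∣ δ r) : ∃ d a : ker δ, ¬ p ∣ d ∧ (p : B) ∣ d * r - a := by
  obtain ⟨b, hb⟩ : ∃ b, ¬ (p : B) ∣ δ b := by
    by_contra! h
    refine hp.not_isUnit (hirr _ ?_)
    rintro _ ⟨b, rfl⟩
    exact Ideal.mem_span_singleton.2 (h b)
  let P : Ideal (ker δ) := Ideal.span {p}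
  let Q : Ideal B := Ideal.span {(p : B)}
  have hPQ : P ≤ Q.comap (algebraMap (ker δ) B) :=
    (Ideal.span_singleton_le_iff_mem _).2 (Ideal.mem_span_singleton_self (p : B))
  let f : (ker δ ⧸ P) →ₐ[ℂ] (B ⧸ Q) := Ideal.quotientMapₐ Q (ker δ).val hPQ
  have hfmk : ∀ a : ker δ, f (Ideal.Quotient.mk P a) = Ideal.Quotient.mk Q (a : B) := fun _ => rfl
  have hinj : Function.Injective f := by
    rw [injective_iff_map_eq_zero]
    intro x hx
    obtain ⟨a, rfl⟩ := Ideal.Quotient.mk_surjective x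
    rw [hfmk, Ideal.Quotient.eq_zero_iff_mem, Ideal.mem_span_singleton] at hx
    rw [Ideal.Quotient.eq_zero_iff_mem, Ideal.mem_span_singleton]
    exact dvd_of_coe_dvd_coe hx
  have hQ : Q.IsPrime := (Ideal.span_singleton_prime hp.ne_zero).2 hp
  have : IsDomain (B ⧸ Q) := Ideal.Quotient.isDomain Q
  have : IsDomain (ker δ ⧸ P) := hinj.isDomain f.toRingHom
  have : CharZero (B ⧸ Q) :=
    charZero_of_injective_algebraMap (algebraMap ℂ (B ⧸ Q)).injective
  have : CharZero (ker δ ⧸ P) := f.toRingHom.charZero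
  have : IsJacobsonRing (ker δ) := isJacobsonRing_of_finiteType (A := ℂ)
  let : Algebra (ker δ ⧸ P) (B ⧸ Q) := f.toRingHom.toAlgebra
  have : IsScalarTower ℂ (ker δ ⧸ P) (B ⧸ Q) := IsScalarTower.of_algebraMap_eq fun c =>
    (f.commutes c).symm
  have : Algebra.FiniteType (ker δ ⧸ P) (B ⧸ Q) :=
    Algebra.FiniteType.of_restrictScalars_finiteType ℂ _ _
  have hg : Ideal.Quotient.mk Q (α * δ b) ≠ 0 := by
    rw [Ne, Ideal.Quotient.eq_zero_iff_mem, Ideal.mem_span_singleton]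
    exact fun h => (hp.dvd_or_dvd h).elim (fun h => hα (dvd_of_coe_dvd_coe h)) hb
  obtain ⟨d, a, hd, hda⟩ := exists_mul_eq_algebraMap_of_forall_isMaximal (R := ker δ ⧸ P)
    (S := B ⧸ Q) hinj (r := Ideal.Quotient.mk Q r) hg (by
      intro 𝔪 h𝔪 hg𝔪
      let 𝔫 := 𝔪.comap (Ideal.Quotient.mk P)
      have h𝔫 : 𝔫.IsMaximal :=
        Ideal.comap_isMaximal_of_surjective _ Ideal.Quotient.mk_surjective
      have hle : 𝔫.map (algebraMap (ker δ) B) ≤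
          (𝔪.map (algebraMap (ker δ ⧸ P) (B ⧸ Q))).comap (Ideal.Quotient.mk Q) := by
        rw [Ideal.map_le_iff_le_comap]
        intro x hx
        exact Ideal.mem_map_of_mem (algebraMap (ker δ ⧸ P) (B ⧸ Q)) (Ideal.mem_comap.1 hx)
      have hα𝔫 : α ∉ 𝔫 := fun h => hg𝔪 (hle (Ideal.mul_mem_right _ _
        (Ideal.mem_map_of_mem (algebraMap (ker δ) B) h)))
      have hb𝔫 : δ b ∉ 𝔫.map (algebraMap (ker δ) B) := fun h =>
        hg𝔪 (hle (Ideal.mul_mem_left _ _ h))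
      have hp𝔫 : p ∈ 𝔫 := by
        rw [Ideal.mem_comap, Ideal.Quotient.eq_zero_iff_mem.2 (Ideal.mem_span_singleton_self p)]
        exact 𝔪.zero_mem
      have hr𝔫 : δ r ∈ 𝔫.map (algebraMap (ker δ) B) :=
        Ideal.mem_of_dvd _ hr (Ideal.mem_map_of_mem (algebraMap (ker δ) B) hp𝔫)
      obtain ⟨c, hc⟩ := exists_sub_algebraMap_mem_of_fiberIsA1 (hfib 𝔫 h𝔫 hα𝔫) hb𝔫 hr𝔫
      refine ⟨algebraMap ℂ _ c, ?_⟩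
      rw [← IsScalarTower.algebraMap_apply]
      exact hle hc)
  obtain ⟨a, rfl⟩ := Ideal.Quotient.mk_surjective a
  obtain ⟨d, rfl⟩ := Ideal.Quotient.mk_surjective d
  refine ⟨d, a, fun hpd => hd ?_, ?_⟩
  · rwa [Ideal.Quotient.eq_zero_iff_mem, Ideal.mem_span_singleton]
  · change Ideal.Quotient.mk Q (d : B) * Ideal.Quotient.mk Q r = Ideal.Quotient.mk Q (a : B) at hda
    rwa [← map_mul, Ideal.Quotient.eq, Ideal.mem_span_singleton] at hda

end Constants

/-! ### Trivial bundles -/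

section TrivialBundle

variable {B : Type*} [CommRing B] [Algebra ℂ B] {δ : Derivation ℂ B B}

/-- If `B = A[x]` with `A = ker δ`, then `δ x` divides every `δ b`; irreducibility makes it a
unit. -/
theorem isUnit_map_symm_X (hirr : IsIrreducible δ) (e : B ≃ₐ[ker δ] (ker δ)[X]) :
    IsUnit (δ (e.symm X)) := by
  refine hirr _ ?_
  rintro _ ⟨b, rfl⟩
  have hb : b = aeval (e.symm X) (e b) := by
    rw [aeval_algHom_apply, aeval_X_left_apply, e.symm_apply_apply]
  rw [hb, map_aeval_ker]
  exact Ideal.mul_mem_left _ _ (Ideal.mem_span_singleton_self _)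

/-- If `B = A[x]` with `A = ker δ`, then `δ` is a unit multiple of `d/dx`, so an element whose
derivative is divisible by `p ∈ A` is congruent modulo `p` to its constant coefficient. -/
theorem exists_dvd_sub_of_dvd_map (hirr : IsIrreducible δ) (e : B ≃ₐ[ker δ] (ker δ)[X])
    {p : ker δ} {r : B} (hr : (p : B) ∣ δ r) : ∃ u : ker δ, (p : B) ∣ r - u := by
  have hb : ∀ P, aeval (e.symm X) P = e.symm P := fun P => by
    rw [aeval_algHom_apply, aeval_X_left_apply]
  have hC : ∀ a : ker δ, e (a : B) = C a := fun a => e.commutes a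
  have h1 : C p ∣ derivative (e r) := by
    rw [← e.symm_apply_apply r, ← hb, map_aeval_ker,
      (isUnit_map_symm_X hirr e).dvd_mul_right] at hr
    have h2 := map_dvd e hr
    rwa [hC, hb, e.apply_symm_apply] at h2
  refine ⟨(e r).coeff 0, ?_⟩
  have h3 : C p ∣ e r - C ((e r).coeff 0) := by
    rw [C_dvd_iff_dvd_coeff] at h1 ⊢
    intro n
    rcases n with _ | n
    · simp
    · have h4 := h1 n
      rw [coeff_derivative] at h4
      -- Characteristic zero: the factor `n + 1` produced by differentiation is a unit.
      have h5 : IsUnit ((n : ker δ) + 1) := by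
        have : IsUnit ((n : ℂ) + 1) := (Nat.cast_add_one_ne_zero n).isUnit
        simpa using this.map (algebraMap ℂ (ker δ))
      rw [h5.dvd_mul_right] at h4
      simpa [coeff_C] using h4
  have h6 := map_dvd e.symm h3
  rwa [map_sub, e.symm_apply_apply, ← hC, ← hC, e.symm_apply_apply, e.symm_apply_apply] at h6

theorem isBirational_of_bijective {R S : Type*} [CommRing R] [CommRing S] [hS : IsDomain S]
    {φ : R →+* S} (hφ : Function.Bijective φ) : IsBirational φ := by
  have : IsDomain R := hφ.1.isDomain _
  refine ⟨hS, hφ.1, RingHom.injective _, fun k => ?_⟩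
  obtain ⟨x, y, hy, rfl⟩ := IsFractionRing.div_surjective (A := S) k
  obtain ⟨x, rfl⟩ := hφ.2 x
  obtain ⟨y, rfl⟩ := hφ.2 y
  refine ⟨algebraMap R _ x / algebraMap R _ y, ?_⟩
  rw [map_div₀, IsFractionRing.map, IsLocalization.map_eq, IsLocalization.map_eq]

theorem isBirational_toKerInduced [IsDomain B] [Module.FaithfullyFlat (ker δ) B]
    (hirr : IsIrreducible δ)
    (e : B ≃ₐ[ker δ] (ker δ)[X]) {f : ker δ} (hf : Prime f) :
    IsBirational (toKerInduced δ f).toRingHom := by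
  have hfB : Prime (f : B) := by
    rw [← MulEquiv.prime_iff e.toMulEquiv]
    have : e.toMulEquiv (f : B) = C f := e.commutes f
    rw [this]
    exact prime_C_iff.2 hf
  have : (Ideal.span {(f : B)}).IsPrime := (Ideal.span_singleton_prime hfB.ne_zero).2 hfB
  have : IsDomain (B ⧸ Ideal.span {(f : B)}) := Ideal.Quotient.isDomain _
  refine isBirational_of_bijective ⟨?_, ?_⟩
  · rw [injective_iff_map_eq_zero]
    intro x hx
    obtain ⟨a, rfl⟩ := Ideal.Quotient.mk_surjective x
    have hx' := congrArg Subtype.val hx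
    change Ideal.Quotient.mk (Ideal.span {(f : B)}) (a : B) = 0 at hx'
    rw [Ideal.Quotient.eq_zero_iff_mem, Ideal.mem_span_singleton] at hx' ⊢
    exact dvd_of_coe_dvd_coe hx'
  · rintro ⟨x, hx⟩
    obtain ⟨r, rfl⟩ := Ideal.Quotient.mk_surjective x
    rw [mem_ker, induced_mk, Ideal.Quotient.eq_zero_iff_mem, Ideal.mem_span_singleton] at hx
    obtain ⟨u, hu⟩ := exists_dvd_sub_of_dvd_map hirr e hx
    refine ⟨Ideal.Quotient.mk _ u, Subtype.ext ?_⟩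
    change Ideal.Quotient.mk (Ideal.span {(f : B)}) (u : B) = Ideal.Quotient.mk _ r
    rw [eq_comm, Ideal.Quotient.eq, Ideal.mem_span_singleton]
    exact hu

/-- The Nullstellensatz: closed points of an affine variety over an algebraically closed field are
rational. -/
theorem exists_algHom_surjective_ker_eq (k : Type*) [Field k] [IsAlgClosed k] {A : Type*}
    [CommRing A] [Algebra k A] [Algebra.FiniteType k A] (𝔪 : Ideal A) [𝔪.IsMaximal] :
    ∃ τ : A →ₐ[k] k, Function.Surjective τ ∧ RingHom.ker (τ : A →+* k) = 𝔪 := by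
  have : Module.Finite k (A ⧸ 𝔪) := by
    let := Ideal.Quotient.field 𝔪
    exact finite_of_finite_type_of_isJacobsonRing k (A ⧸ 𝔪)
  let σ : k ≃ₐ[k] (A ⧸ 𝔪) := AlgEquiv.ofBijective (Algebra.ofId k (A ⧸ 𝔪))
    IsAlgClosed.algebraMap_bijective_of_isIntegral
  refine ⟨σ.symm.toAlgHom.comp (Ideal.Quotient.mkₐ k 𝔪),
    σ.symm.surjective.comp Ideal.Quotient.mk_surjective, ?_⟩
  ext x
  exact (map_eq_zero_iff _ σ.symm.injective).trans Ideal.Quotient.eq_zero_iff_mem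

theorem fiberIsA1_of_algEquiv [Algebra.FiniteType ℂ (ker δ)] (e : B ≃ₐ[ker δ] (ker δ)[X])
    (𝔪 : Ideal (ker δ)) [𝔪.IsMaximal] : FiberIsA1 (ker δ) B 𝔪 := by
  obtain ⟨τ, hτs, hτ⟩ := exists_algHom_surjective_ker_eq ℂ 𝔪
  let φ : B →ₐ[ℂ] ℂ[X] := (Polynomial.mapAlgHom τ).comp
    (e.restrictScalars ℂ : B →ₐ[ℂ] (ker δ)[X])
  have hφs : Function.Surjective φ := (Polynomial.map_surjective _ hτs).comp e.surjective
  have hker : 𝔪.map (algebraMap (ker δ) B) = RingHom.ker φ := by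
    have h1 : (𝔪.map (algebraMap (ker δ) B)).map (e : B →+* (ker δ)[X]) = 𝔪.map C := by
      rw [Ideal.map_map]
      congr 1
      ext1 a
      exact e.commutes a
    have h2 : RingHom.ker (mapRingHom (τ : ker δ →+* ℂ)) = 𝔪.map C := by
      rw [Polynomial.ker_mapRingHom, hτ]
    ext x
    have h3 : x ∈ RingHom.ker φ ↔ e x ∈ RingHom.ker (mapRingHom (τ : ker δ →+* ℂ)) := Iff.rfl
    rw [h3, h2, ← h1]
    constructor
    · exact fun h => Ideal.mem_map_of_mem _ h
    · intro h
      obtain ⟨y, hy, hyx⟩ := (Ideal.mem_map_iff_of_surjective (e : B →+* (ker δ)[X])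
        e.surjective).1 h
      rwa [← e.injective hyx]
  exact ⟨(Ideal.quotientEquivAlgOfEq ℂ hker).trans
    (Ideal.quotientKerAlgEquivOfSurjective hφs)⟩

theorem exists_height_span_singleton_eq_one {A : Type*} [CommRing A] [IsDomain A]
    [IsNoetherianRing A] (hA : ¬ IsField A) : ∃ a : A, (Ideal.span {a}).height = 1 := by
  obtain ⟨a, ha0, ha⟩ := Ring.exists_not_isUnit_of_not_isField hA
  exact ⟨a, Ideal.height_span_singleton_eq_one_of_mem_nonZeroDivisors
    (mem_nonZeroDivisors_of_ne_zero ha0) ha⟩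

theorem not_isField_of_algEquiv [IsDomain B] (hdim : 2 ≤ ringKrullDim B)
    (e : B ≃ₐ[ker δ] (ker δ)[X]) : ¬ IsField (ker δ) := by
  intro h
  have : IsNoetherianRing (ker δ) := by
    let := h.toField
    infer_instance
  rw [ringKrullDim_eq_of_ringEquiv e.toRingEquiv, ringKrullDim_of_isNoetherianRing,
    ringKrullDim_eq_zero_of_isField h] at hdim
  exact absurd hdim (by decide)

end TrivialBundle

end GaQuotient

theorem theorem3p5 {B : Type*} [CommRing B] [IsDomain B] [Algebra ℂ B]
    [Algebra.FiniteType ℂ B] [UniqueFactorizationMonoid B]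
    (hdim : 2 ≤ ringKrullDim B)
    (δ : Derivation ℂ B B)
    (hnil : GaQuotient.IsLocallyNilpotent δ)
    (hirr : GaQuotient.IsIrreducible δ)
    (haff : Algebra.FiniteType ℂ (GaQuotient.ker δ))
    (hff : Module.FaithfullyFlat (GaQuotient.ker δ) B) :
    GaQuotient.IsTrivialA1Bundle (GaQuotient.ker δ) B ↔
      ∃ α : GaQuotient.ker δ,
        (Ideal.span {α}).height = 1 ∧
        (∀ 𝔪 : Ideal (GaQuotient.ker δ), 𝔪.IsMaximal → α ∉ 𝔪 →
          GaQuotient.FiberIsA1 (GaQuotient.ker δ) B 𝔪) ∧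
        (∀ f : GaQuotient.ker δ, Prime f → f ∣ α →
          GaQuotient.IsBirational (GaQuotient.toKerInduced δ f).toRingHom) := by
  constructor
  · rintro ⟨e⟩
    have : IsNoetherianRing (GaQuotient.ker δ) := Algebra.FiniteType.isNoetherianRing ℂ _
    obtain ⟨α, hα⟩ := GaQuotient.exists_height_span_singleton_eq_one
      (GaQuotient.not_isField_of_algEquiv hdim e)
    exact ⟨α, hα, fun 𝔪 _ _ => GaQuotient.fiberIsA1_of_algEquiv e 𝔪,
      fun f hf _ => GaQuotient.isBirational_toKerInduced hirr e hf⟩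
  · rintro ⟨α, -, hfib, hbir⟩
    obtain ⟨s, hs⟩ := GaQuotient.exists_slice hnil
      (by
        by_contra! h
        -- An irreducible derivation is nonzero.
        refine not_isUnit_zero (hirr 0 ?_)
        rintro _ ⟨b, rfl⟩
        rw [h b]
        exact Ideal.zero_mem _)
      (fun p hp r hr => by
        obtain ⟨d, a, hd, hda⟩ : ∃ d a : GaQuotient.ker δ, ¬ p ∣ d ∧ (p : B) ∣ d * r - a := by
          -- Over the primes dividing `α` birationality applies, over the others the fibres do.
          by_cases hpα : p ∣ α
          · refine GaQuotient.exists_dvd_mul_sub_of_isBirational (hbir p ?_ hpα) hr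
            refine ⟨fun h => hp.ne_zero (by rw [h]; rfl),
              fun h => hp.not_isUnit (h.map (GaQuotient.ker δ).val), fun a b hab => ?_⟩
            exact (hp.dvd_or_dvd (map_dvd (GaQuotient.ker δ).val hab)).imp
              GaQuotient.dvd_of_coe_dvd_coe GaQuotient.dvd_of_coe_dvd_coe
          · exact GaQuotient.exists_dvd_mul_sub_of_forall_fiberIsA1 hirr hp hpα hfib hr
        exact GaQuotient.exists_dvd_sub_of_dvd_mul_sub hp hd hda)
    exact GaQuotient.isTrivialA1Bundle_of_slice hnil hs
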